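/- Let $\mathfrak g$ be a finite-dimensional real semisimple Lie algebra with Killing form $B$, let $\sigma$ be a Cartan involution of $\mathfrak g$ and put $B_\sigma(X,Y)=-B(X,\sigma Y)$, a positive definite inner product. Let $\mathfrak p$ be the $(-1)$-eigenspace of $\sigma$, let $\mathfrak a\subset\mathfrak p$ be a maximal abelian subspace, let $\Delta$ be the set of restricted roots of $(\mathfrak g,\mathfrak a)$ with root spaces $\mathfrak g_\alpha$, and let $H_\alpha\in\mathfrak a$ be the root vector of $\alpha\in\Delta$, defined by $B_\sigma(H_\alpha,A)=\alpha(A)$ for all $A\in\mathfrak a$. Let $\Lambda\subset\Delta$ be a set of simple roots and $\Delta^+$ the corresponding set of positive roots. For a subset $\Lambda'\subseteq\Lambda$ let $\langle\Lambda'\rangle$ be the set of roots in the linear span of $\Lambda'$, and put $$\mathfrak a_{\Lambda'}=\{A\in\mathfrak a : B_\sigma(H_\beta,A)=0\text{ for all }\beta\in\langle\Lambda'\rangle\},\qquad \mathfrak n_{\Lambda'}=\sum_{\beta\in\Delta^+\setminus\langle\Lambda'\rangle}\mathfrak g_\beta,\qquad \mathfrak s_{\Lambda'}=\mathfrak a_{\Lambda'}\oplus\mathfrak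 n_{\Lambda'}.$$ The solvable Lie algebra $\mathfrak s_{\Lambda'}$ with the inner product $\langle\,,\rangle=2B_\sigma|_{\mathfrak a_{\Lambda'}\times\mathfrak a_{\Lambda'}}+B_\sigma|_{\mathfrak n_{\Lambda'}\times\mathfrak n_{\Lambda'}}$ is called the attached solvmanifold; it is identified with the simply connected Lie group with Lie algebra $\mathfrak s_{\Lambda'}$ and the induced left-invariant Riemannian metric. The Levi-Civita connection of a metric Lie algebra, on left-invariant vector fields, is $$\nabla_XY=\tfrac12[X,Y]+U(X,Y),\qquad 2\langle U(X,Y),Z\rangle=\langle[Z,X],Y\rangle+\langle X,[Z,Y]\rangle .$$ Theorem. For every $\Lambda'\subseteq\Lambda$, the attached solvmanifold $(\mathfrak s_{\Lambda'},\langle\,,\rangle)$ is a minimal Riemannian submanifold of the symmetric space $(\mathfrak s_\emptyset,\langle\,,\rangle)$. That is, the inclusion $\mathfrak s_{\Lambda'}\subseteq\mathfrak s_\emptyset$ is an isometric embedding of metric Lie algebras, and the second fundamental form $h(X,Y)=\nabla^{\mathfrak s_\emptyset}_XY-\nabla^{\mathfrak s_{\Lambda'}}_XY$ $(X,Y\in\mathfrak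 s_{\Lambda'})$ has vanishing trace: $\sum_i h(E_i,E_i)=0$ for every orthonormal basis $\{E_i\}$ of $\mathfrak s_{\Lambda'}$. -/

import Mathlib

noncomputable section

namespace Solvmanifold

/-! ### Metric Lie algebras -/

/-- An inner product on a real vector space: a positive definite symmetric bilinear form. -/
structure InnerProduct (V : Type*) [AddCommGroup V] [Module ℝ V] where
  form : LinearMap.BilinForm ℝ V
  symm : ∀ x y, form x y = form y x
  pos : ∀ x, x ≠ 0 → 0 < form x x

namespace InnerProduct

section Linear

variable {V : Type*} [AddCommGroup V] [Module ℝ V]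

theorem nonneg (g : InnerProduct V) (x : V) : 0 ≤ g.form x x := by
  by_cases h : x = 0
  · simp [h]
  · exact (g.pos x h).le

theorem eq_zero_of_forall (g : InnerProduct V) {x : V} (h : ∀ y, g.form x y = 0) : x = 0 := by
  by_contra hx
  exact (g.pos x hx).ne' (h x)

theorem nondegenerate (g : InnerProduct V) : g.form.Nondegenerate := by
  refine ⟨fun x hx => g.eq_zero_of_forall hx, fun x hx => g.eq_zero_of_forall fun y => ?_⟩
  rw [g.symm]
  exact hx y

/-- The restriction of an inner product to a subspace. -/
def restrict (g : InnerProduct V) (W : Submodule ℝ V) : InnerProduct W where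
  form := g.form.restrict W
  symm x y := g.symm x y
  pos x hx := g.pos x (by simpa using hx)

/-- The vector representing a linear functional: `⟨riesz f, y⟩ = f y` for all `y`. -/
def riesz [FiniteDimensional ℝ V] (g : InnerProduct V) : Module.Dual ℝ V ≃ₗ[ℝ] V :=
  (g.form.toDual g.nondegenerate).symm

theorem form_riesz [FiniteDimensional ℝ V] (g : InnerProduct V) (f : Module.Dual ℝ V) (y : V) :
    g.form (g.riesz f) y = f y :=
  LinearMap.BilinForm.apply_toDual_symm_apply (hB := g.nondegenerate) f y

/-- A basis is orthonormal for `g`. -/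
def IsOrthonormalBasis (g : InnerProduct V) {n : ℕ} (e : Module.Basis (Fin n) ℝ V) : Prop :=
  ∀ i j, g.form (e i) (e j) = if i = j then 1 else 0

theorem exists_isOrthonormalBasis [FiniteDimensional ℝ V] (g : InnerProduct V) :
    ∃ e : Module.Basis (Fin (Module.finrank ℝ V)) ℝ V, g.IsOrthonormalBasis e := by
  obtain ⟨v, hv⟩ := LinearMap.BilinForm.exists_orthogonal_basis (B := g.form) ⟨g.symm⟩
  have hpos : ∀ i, 0 < g.form (v i) (v i) := fun i => g.pos _ (v.ne_zero i)
  have hne : ∀ i, Real.sqrt (g.form (v i) (v i)) ≠ 0 := fun i => (Real.sqrt_pos.2 (hpos i)).ne'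
  refine ⟨v.isUnitSMul (w := fun i => (Real.sqrt (g.form (v i) (v i)))⁻¹)
    (fun i => (isUnit_iff_ne_zero.2 (inv_ne_zero (hne i)))), fun i j => ?_⟩
  simp only [Module.Basis.isUnitSMul_apply, map_smul, LinearMap.smul_apply, smul_eq_mul]
  split_ifs with h
  · subst h
    have := Real.mul_self_sqrt (hpos i).le
    have h1 := hne i
    field_simp
    nlinarith
  · have : g.form (v i) (v j) = 0 := hv h
    simp [this]

end Linear

section Lie

variable {L : Type*} [LieRing L] [LieAlgebra ℝ L] [FiniteDimensional ℝ L]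

/-- The symmetric bilinear map `U` of a metric Lie algebra, determined by
`2⟨U(X,Y),Z⟩ = ⟨[Z,X],Y⟩ + ⟨X,[Z,Y]⟩`. -/
def U (g : InnerProduct L) (X Y : L) : L :=
  g.riesz ((1 / 2 : ℝ) • (-(g.form.flip Y ∘ₗ LieAlgebra.ad ℝ L X)
    - g.form X ∘ₗ LieAlgebra.ad ℝ L Y : Module.Dual ℝ L))

theorem two_mul_form_U (g : InnerProduct L) (X Y Z : L) :
    2 * g.form (g.U X Y) Z = g.form ⁅Z, X⁆ Y + g.form X ⁅Z, Y⁆ := by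
  rw [U, form_riesz]
  simp only [LinearMap.smul_apply, LinearMap.sub_apply, LinearMap.neg_apply,
    LinearMap.comp_apply, smul_eq_mul]
  change 2 * (1 / 2 * (-g.form ⁅X, Z⁆ Y - g.form X ⁅Y, Z⁆)) = _
  rw [← lie_skew Z X, ← lie_skew Z Y, map_neg, map_neg, LinearMap.neg_apply]
  ring

/-- The Levi-Civita connection of the left-invariant metric, evaluated on left-invariant vector
fields: `∇_X Y = (1/2)[X,Y] + U(X,Y)`. -/
def leviCivita (g : InnerProduct L) (X Y : L) : L :=
  (1 / 2 : ℝ) • ⁅X, Y⁆ + g.U X Y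

/-- The Koszul formula for left-invariant vector fields. -/
theorem two_mul_form_leviCivita (g : InnerProduct L) (X Y Z : L) :
    2 * g.form (g.leviCivita X Y) Z =
      g.form ⁅X, Y⁆ Z + g.form ⁅Z, X⁆ Y + g.form X ⁅Z, Y⁆ := by
  have := g.two_mul_form_U X Y Z
  simp only [leviCivita, map_add, map_smul, LinearMap.add_apply, LinearMap.smul_apply,
    smul_eq_mul]
  linarith

theorem leviCivita_torsion_free (g : InnerProduct L) (X Y : L) :
    g.leviCivita X Y - g.leviCivita Y X = ⁅X, Y⁆ := by
  rw [← sub_eq_zero]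
  refine g.eq_zero_of_forall fun Z => ?_
  have h1 := g.two_mul_form_leviCivita X Y Z
  have h2 := g.two_mul_form_leviCivita Y X Z
  rw [← lie_skew Y X, g.symm ⁅Z, Y⁆ X, g.symm Y ⁅Z, X⁆] at h2
  simp only [map_sub, map_neg, LinearMap.sub_apply, LinearMap.neg_apply] at *
  linarith

theorem leviCivita_metric (g : InnerProduct L) (X Y Z : L) :
    g.form (g.leviCivita X Y) Z + g.form Y (g.leviCivita X Z) = 0 := by
  have h1 := g.two_mul_form_leviCivita X Y Z
  have h2 := g.two_mul_form_leviCivita X Z Y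
  rw [g.symm Y (g.leviCivita X Z)]
  rw [← lie_skew X Z, ← lie_skew Y X, ← lie_skew Y Z] at h2
  simp only [map_neg, LinearMap.neg_apply] at h2
  rw [g.symm ⁅X, Y⁆ Z] at h1 h2
  linarith [g.symm ⁅X, Y⁆ Z]

end Lie

end InnerProduct

section Submanifold

variable {H L : Type*} [LieRing H] [LieAlgebra ℝ H] [FiniteDimensional ℝ H]
  [LieRing L] [LieAlgebra ℝ L] [FiniteDimensional ℝ L]

/-- The second fundamental form `h(X,Y) = ∇^L_X Y - ∇^H_X Y` of a metric Lie algebra `(H, gH)`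
sitting in a metric Lie algebra `(L, gL)` through the homomorphism `ι`. -/
def secondFundamentalForm (gH : InnerProduct H) (gL : InnerProduct L) (ι : H →ₗ⁅ℝ⁆ L)
    (X Y : H) : L :=
  gL.leviCivita (ι X) (ι Y) - ι (gH.leviCivita X Y)

/-- `(H, gH)` is, through `ι`, a minimal Riemannian submanifold of `(L, gL)`: the map `ι` is an
isometric embedding and the trace of the second fundamental form, computed in any orthonormal
basis, vanishes. -/
structure IsMinimalSubmanifold (gH : InnerProduct H) (gL : InnerProduct L) (ι : H →ₗ⁅ℝ⁆ L) :
    Prop where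
  injective : Function.Injective ι
  isometric : ∀ X Y : H, gL.form (ι X) (ι Y) = gH.form X Y
  trace_eq_zero : ∀ {n : ℕ} (e : Module.Basis (Fin n) ℝ H), gH.IsOrthonormalBasis e →
    ∑ i, secondFundamentalForm gH gL ι (e i) (e i) = 0

end Submanifold

/-! ### Cartan involutions, restricted roots, and attached solvmanifolds -/

section Defs

variable {𝔤 : Type*} [LieRing 𝔤] [LieAlgebra ℝ 𝔤]

/-- The bilinear form `B_σ(X,Y) = -B(X, σ Y)`, where `B` is the Killing form. -/
def cartanForm (σ : 𝔤 ≃ₗ⁅ℝ⁆ 𝔤) : LinearMap.BilinForm ℝ 𝔤 :=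
  -(killingForm ℝ 𝔤).compl₂ (σ : 𝔤 →ₗ[ℝ] 𝔤)

/-- `σ` is a Cartan involution: an involutive automorphism such that `B_σ` is positive
definite. -/
structure IsCartanInvolution (σ : 𝔤 ≃ₗ⁅ℝ⁆ 𝔤) : Prop where
  involutive : ∀ X, σ (σ X) = X
  pos : ∀ X, X ≠ 0 → 0 < cartanForm σ X X

/-- `𝔞` is a maximal abelian subspace of `𝔭`, the `(-1)`-eigenspace of `σ`. -/
def IsMaximalAbelianSubspace (σ : 𝔤 ≃ₗ⁅ℝ⁆ 𝔤) (𝔞 : Submodule ℝ 𝔤) : Prop :=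
  Maximal (fun 𝔟 : Submodule ℝ 𝔤 => (∀ X ∈ 𝔟, σ X = -X) ∧ ∀ X ∈ 𝔟, ∀ Y ∈ 𝔟, ⁅X, Y⁆ = 0) 𝔞

/-- `𝔤_α = {X | [A,X] = α(A) X for all A ∈ 𝔞}`. -/
def rootSpace (𝔞 : Submodule ℝ 𝔤) (α : Module.Dual ℝ 𝔞) : Submodule ℝ 𝔤 where
  carrier := {X | ∀ A : 𝔞, ⁅(A : 𝔤), X⁆ = α A • X}
  add_mem' {X Y} hX hY A := by rw [lie_add, hX A, hY A, smul_add]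
  zero_mem' A := by simp
  smul_mem' c X hX A := by rw [lie_smul, hX A, smul_comm]

/-- The set `Δ` of restricted roots of `𝔤` with respect to `𝔞`. -/
def roots (𝔞 : Submodule ℝ 𝔤) : Set (Module.Dual ℝ 𝔞) :=
  {α | α ≠ 0 ∧ rootSpace 𝔞 α ≠ ⊥}

/-- `Λ` is a set of simple roots of `Δ`: it is a linearly independent set of roots, and every
root is a linear combination of elements of `Λ` with integer coefficients which are all
non-negative or all non-positive. -/
structure IsSimpleSystem (𝔞 : Submodule ℝ 𝔤) (Λ : Set (Module.Dual ℝ 𝔞)) : Prop where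
  subset_roots : Λ ⊆ roots 𝔞
  linearIndepOn : LinearIndepOn ℝ id Λ
  pos_or_neg : ∀ α ∈ roots 𝔞, α ∈ AddSubmonoid.closure Λ ∨ -α ∈ AddSubmonoid.closure Λ

end Defs

/-- The choices made in the structure theory of `𝔤`: a Cartan involution `σ`, a maximal abelian
subspace `𝔞` of `𝔭`, and a set `Λ` of simple roots of the restricted root system. -/
structure IwasawaData (𝔤 : Type*) [LieRing 𝔤] [LieAlgebra ℝ 𝔤] where
  σ : 𝔤 ≃ₗ⁅ℝ⁆ 𝔤
  isCartanInvolution : IsCartanInvolution σ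
  𝔞 : Submodule ℝ 𝔤
  isMaximalAbelianSubspace : IsMaximalAbelianSubspace σ 𝔞
  Λ : Set (Module.Dual ℝ 𝔞)
  isSimpleSystem : IsSimpleSystem 𝔞 Λ

namespace IwasawaData

variable {𝔤 : Type*} [LieRing 𝔤] [LieAlgebra ℝ 𝔤] (D : IwasawaData 𝔤)

/-- `B_σ` as an inner product on `𝔤`. -/
def Bσ : InnerProduct 𝔤 where
  form := cartanForm D.σ
  symm X Y := by
    have h := LieAlgebra.killingForm_of_equiv_apply D.σ X (D.σ Y)
    rw [D.isCartanInvolution.involutive] at h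
    simp only [cartanForm, LinearMap.neg_apply, LinearMap.compl₂_apply, neg_inj]
    change killingForm ℝ 𝔤 X (D.σ Y) = killingForm ℝ 𝔤 Y (D.σ X)
    rw [← h, LieModule.traceForm_comm]
  pos := D.isCartanInvolution.pos

theorem Bσ_apply (X Y : 𝔤) : D.Bσ.form X Y = -killingForm ℝ 𝔤 X (D.σ Y) := rfl

theorem σ_apply_of_mem {A : 𝔤} (hA : A ∈ D.𝔞) : D.σ A = -A :=
  D.isMaximalAbelianSubspace.1.1 A hA

theorem lie_eq_zero {A A' : 𝔤} (hA : A ∈ D.𝔞) (hA' : A' ∈ D.𝔞) : ⁅A, A'⁆ = 0 :=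
  D.isMaximalAbelianSubspace.1.2 A hA A' hA'

theorem Bσ_lie (X Y Z : 𝔤) : D.Bσ.form ⁅Z, X⁆ Y = -D.Bσ.form X ⁅D.σ Z, Y⁆ := by
  simp only [Bσ_apply, LieEquiv.map_lie, D.isCartanInvolution.involutive, neg_neg]
  rw [← lie_skew Z X, map_neg, LinearMap.neg_apply, neg_neg,
    LieModule.traceForm_apply_lie_apply]

/-- The set `Δ⁺` of positive roots. -/
def posRoots : Set (Module.Dual ℝ D.𝔞) := {α ∈ roots D.𝔞 | α ∈ AddSubmonoid.closure D.Λ}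

/-- `⟨Λ'⟩`, the set of roots spanned by `Λ'`. -/
def spannedRoots (Λ' : Set (Module.Dual ℝ D.𝔞)) : Set (Module.Dual ℝ D.𝔞) :=
  {α ∈ roots D.𝔞 | α ∈ Submodule.span ℝ Λ'}

/-- `𝔫_{Λ'} = ∑_{β ∈ Δ⁺ \ ⟨Λ'⟩} 𝔤_β`. -/
def nilPart (Λ' : Set (Module.Dual ℝ D.𝔞)) : Submodule ℝ 𝔤 :=
  ⨆ β ∈ D.posRoots \ D.spannedRoots Λ', rootSpace D.𝔞 β

section FiniteDimensional

variable [FiniteDimensional ℝ 𝔤]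

/-- The root vector `H_α ∈ 𝔞`, characterized by `B_σ(H_α, A) = α(A)` for all `A ∈ 𝔞`. -/
def rootVector (α : Module.Dual ℝ D.𝔞) : D.𝔞 := (D.Bσ.restrict D.𝔞).riesz α

theorem Bσ_rootVector (α : Module.Dual ℝ D.𝔞) (A : D.𝔞) :
    D.Bσ.form (D.rootVector α) A = α A :=
  (D.Bσ.restrict D.𝔞).form_riesz α A

/-- `𝔞_{Λ'} = ⋂_{β ∈ ⟨Λ'⟩} H_β^⊥`, the orthogonal complements being taken in `𝔞`. -/
def abelPart (Λ' : Set (Module.Dual ℝ D.𝔞)) : Submodule ℝ 𝔤 where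
  carrier := {A | A ∈ D.𝔞 ∧ ∀ β ∈ D.spannedRoots Λ', D.Bσ.form (D.rootVector β) A = 0}
  add_mem' hX hY := ⟨add_mem hX.1 hY.1, fun β hβ => by
    rw [map_add, hX.2 β hβ, hY.2 β hβ, add_zero]⟩
  zero_mem' := ⟨zero_mem _, fun β _ => by simp⟩
  smul_mem' c X hX := ⟨Submodule.smul_mem _ c hX.1, fun β hβ => by
    rw [map_smul, hX.2 β hβ, smul_zero]⟩

end FiniteDimensional

theorem exists_height {Λ' : Set (Module.Dual ℝ D.𝔞)} (hΛ' : Λ' ⊆ D.Λ) :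
    ∃ f : Module.Dual ℝ D.𝔞 →ₗ[ℝ] ℝ, (∀ α ∈ Submodule.span ℝ Λ', f α = 0) ∧
      ∀ α ∈ AddSubmonoid.closure D.Λ, 0 ≤ f α ∧ (f α = 0 → α ∈ Submodule.span ℝ Λ') := by
  classical
  let b := Module.Basis.extend D.isSimpleSystem.linearIndepOn
  let f : Module.Dual ℝ D.𝔞 →ₗ[ℝ] ℝ :=
    b.constr ℝ fun i => if (i : Module.Dual ℝ D.𝔞) ∈ Λ' then (0 : ℝ) else 1
  have hf : ∀ α ∈ D.Λ, f α = if α ∈ Λ' then (0 : ℝ) else 1 := by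
    intro α hα
    have hmem := Module.Basis.subset_extend D.isSimpleSystem.linearIndepOn hα
    have h1 : b ⟨α, hmem⟩ = α := Module.Basis.extend_apply_self _ _
    have h2 := b.constr_basis ℝ (fun i => if (i : Module.Dual ℝ D.𝔞) ∈ Λ' then (0 : ℝ) else 1)
      ⟨α, hmem⟩
    rw [h1] at h2
    exact h2
  refine ⟨f, fun α hα => ?_, fun α hα => ?_⟩
  · have : Submodule.span ℝ Λ' ≤ LinearMap.ker f :=
      Submodule.span_le.2 fun β hβ => by simp [hf β (hΛ' hβ), hβ]
    exact this hα
  · induction hα using AddSubmonoid.closure_induction with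
    | mem x hx =>
      rw [hf x hx]
      split_ifs with h
      · exact ⟨le_rfl, fun _ => Submodule.subset_span h⟩
      · exact ⟨zero_le_one, fun h => absurd h one_ne_zero⟩
    | zero => exact ⟨by simp, fun _ => zero_mem _⟩
    | add x y _ _ hx hy =>
      rw [map_add]
      refine ⟨add_nonneg hx.1 hy.1, fun h => ?_⟩
      exact add_mem (hx.2 (by linarith [hx.1, hy.1])) (hy.2 (by linarith [hx.1, hy.1]))

theorem lie_mem_rootSpace {α β : Module.Dual ℝ D.𝔞} {X Y : 𝔤} (hX : X ∈ rootSpace D.𝔞 α)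
    (hY : Y ∈ rootSpace D.𝔞 β) : ⁅X, Y⁆ ∈ rootSpace D.𝔞 (α + β) := by
  intro A
  rw [leibniz_lie, hX A, hY A, smul_lie, lie_smul, LinearMap.add_apply, add_smul]

theorem rootSpace_le_nilPart {Λ' : Set (Module.Dual ℝ D.𝔞)} {β : Module.Dual ℝ D.𝔞}
    (hβ : β ∈ D.posRoots \ D.spannedRoots Λ') : rootSpace D.𝔞 β ≤ D.nilPart Λ' :=
  le_iSup₂_of_le β hβ le_rfl

theorem lie_mem_nilPart_of_mem {Λ' : Set (Module.Dual ℝ D.𝔞)} {A X : 𝔤} (hA : A ∈ D.𝔞)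
    (hX : X ∈ D.nilPart Λ') : ⁅A, X⁆ ∈ D.nilPart Λ' := by
  suffices h : D.nilPart Λ' ≤ (D.nilPart Λ').comap (LieAlgebra.ad ℝ 𝔤 A : 𝔤 →ₗ[ℝ] 𝔤) from h hX
  refine iSup₂_le fun β hβ Y hY => ?_
  have h : ⁅A, Y⁆ = β ⟨A, hA⟩ • Y := hY ⟨A, hA⟩
  simp only [Submodule.mem_comap, LieAlgebra.ad_apply, h]
  exact Submodule.smul_mem _ _ (D.rootSpace_le_nilPart hβ hY)

theorem lie_mem_nilPart {Λ' : Set (Module.Dual ℝ D.𝔞)} (hΛ' : Λ' ⊆ D.Λ) {X Y : 𝔤}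
    (hX : X ∈ D.nilPart Λ') (hY : Y ∈ D.nilPart Λ') : ⁅X, Y⁆ ∈ D.nilPart Λ' := by
  obtain ⟨f, hf0, hf⟩ := D.exists_height hΛ'
  have key : ∀ α ∈ D.posRoots \ D.spannedRoots Λ', ∀ β ∈ D.posRoots \ D.spannedRoots Λ',
      ∀ X ∈ rootSpace D.𝔞 α, ∀ Y ∈ rootSpace D.𝔞 β, ⁅X, Y⁆ ∈ D.nilPart Λ' := by
    intro α hα β hβ X hX Y hY
    by_cases h0 : ⁅X, Y⁆ = 0
    · rw [h0]
      exact zero_mem _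
    have hmem := D.lie_mem_rootSpace hX hY
    have hpos : ∀ γ ∈ D.posRoots \ D.spannedRoots Λ', 0 < f γ := fun γ hγ =>
      lt_of_le_of_ne (hf γ hγ.1.2).1 fun h => hγ.2 ⟨hγ.1.1, (hf γ hγ.1.2).2 h.symm⟩
    have hsum : 0 < f (α + β) := by
      rw [map_add]
      exact add_pos (hpos α hα) (hpos β hβ)
    refine D.rootSpace_le_nilPart ⟨⟨⟨?_, ?_⟩, add_mem hα.1.2 hβ.1.2⟩, ?_⟩ hmem
    · intro h
      rw [h, map_zero] at hsum
      exact lt_irrefl _ hsum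
    · intro h
      rw [h] at hmem
      exact h0 (by simpa using hmem)
    · intro h
      exact hsum.ne' (hf0 _ h.2)
  suffices h : D.nilPart Λ' ≤ (D.nilPart Λ').comap (LieAlgebra.ad ℝ 𝔤 X : 𝔤 →ₗ[ℝ] 𝔤) from h hY
  refine iSup₂_le fun β hβ Y hY => ?_
  suffices h : D.nilPart Λ' ≤ (D.nilPart Λ').comap (LieAlgebra.ad ℝ 𝔤 Y : 𝔤 →ₗ[ℝ] 𝔤) by
    have := h hX
    simp only [Submodule.mem_comap, LieAlgebra.ad_apply] at this ⊢
    rw [← lie_skew]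
    exact neg_mem this
  refine iSup₂_le fun α hα X hX => ?_
  simp only [Submodule.mem_comap, LieAlgebra.ad_apply]
  exact key β hβ α hα Y hY X hX

theorem Bσ_eq_zero_of_mem_nilPart {Λ' : Set (Module.Dual ℝ D.𝔞)} {A X : 𝔤} (hA : A ∈ D.𝔞)
    (hX : X ∈ D.nilPart Λ') : D.Bσ.form A X = 0 := by
  suffices h : D.nilPart Λ' ≤ LinearMap.ker (D.Bσ.form A) from h hX
  refine iSup₂_le fun β hβ Y hY => ?_
  obtain ⟨A', hA'⟩ : ∃ A', β A' ≠ 0 := by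
    by_contra! h
    exact hβ.1.1.1 (LinearMap.ext h)
  have h1 := D.Bσ_lie A Y A'
  rw [D.lie_eq_zero A'.2 hA, D.σ_apply_of_mem A'.2, neg_lie, hY A'] at h1
  simp only [map_zero, LinearMap.zero_apply, map_neg, neg_neg, map_smul, smul_eq_mul] at h1
  simpa [hA'] using h1.symm

theorem nilPart_le_nilPart_empty (Λ' : Set (Module.Dual ℝ D.𝔞)) :
    D.nilPart Λ' ≤ D.nilPart ∅ := by
  refine iSup₂_le fun β hβ => D.rootSpace_le_nilPart ⟨hβ.1, fun h => h.1.1 ?_⟩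
  simpa using h.2

variable [FiniteDimensional ℝ 𝔤]

theorem abelPart_le (Λ' : Set (Module.Dual ℝ D.𝔞)) : D.abelPart Λ' ≤ D.𝔞 := fun _ h => h.1

theorem abelPart_empty : D.abelPart ∅ = D.𝔞 := by
  refine le_antisymm (D.abelPart_le ∅) fun A hA => ⟨hA, fun β hβ => absurd ?_ hβ.1.1⟩
  simpa using hβ.2

variable {Λ' : Set (Module.Dual ℝ D.𝔞)}

/-- The solvable Lie algebra `𝔰_{Λ'} = 𝔞_{Λ'} + 𝔫_{Λ'}`. -/
def solv (hΛ' : Λ' ⊆ D.Λ) : LieSubalgebra ℝ 𝔤 where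
  toSubmodule := D.abelPart Λ' ⊔ D.nilPart Λ'
  lie_mem' {X Y} hX hY := by
    obtain ⟨A, hA, N, hN, rfl⟩ := Submodule.mem_sup.1 hX
    obtain ⟨A', hA', N', hN', rfl⟩ := Submodule.mem_sup.1 hY
    refine Submodule.mem_sup_right ?_
    rw [add_lie, lie_add, lie_add, D.lie_eq_zero hA.1 hA'.1, zero_add, ← lie_skew N A']
    exact add_mem (D.lie_mem_nilPart_of_mem hA.1 hN')
      (add_mem (neg_mem (D.lie_mem_nilPart_of_mem hA'.1 hN)) (D.lie_mem_nilPart hΛ' hN hN'))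

/-- `𝔰_{Λ'}` is the direct sum of `𝔞_{Λ'}` and `𝔫_{Λ'}`. -/
theorem isCompl_solv (hΛ' : Λ' ⊆ D.Λ) :
    IsCompl ((D.abelPart Λ').submoduleOf (D.solv hΛ').toSubmodule)
      ((D.nilPart Λ').submoduleOf (D.solv hΛ').toSubmodule) := by
  constructor
  · rw [Submodule.disjoint_def]
    intro X hX hX'
    by_contra h
    have hne : (X : 𝔤) ≠ 0 := by simpa using h
    exact (D.Bσ.pos X hne).ne' (D.Bσ_eq_zero_of_mem_nilPart hX.1 hX')
  · rw [codisjoint_iff, ← Submodule.submoduleOf_sup_of_le le_sup_left le_sup_right,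
      Submodule.submoduleOf_eq_top]
    exact le_rfl

/-- The `𝔞_{Λ'}`-component of an element of `𝔰_{Λ'} = 𝔞_{Λ'} ⊕ 𝔫_{Λ'}`. -/
def abelComponent (hΛ' : Λ' ⊆ D.Λ) : D.solv hΛ' →ₗ[ℝ] 𝔤 :=
  (D.solv hΛ').toSubmodule.subtype ∘ₗ Submodule.projection _ _ (D.isCompl_solv hΛ')

/-- The `𝔫_{Λ'}`-component of an element of `𝔰_{Λ'} = 𝔞_{Λ'} ⊕ 𝔫_{Λ'}`. -/
def nilComponent (hΛ' : Λ' ⊆ D.Λ) : D.solv hΛ' →ₗ[ℝ] 𝔤 :=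
  (D.solv hΛ').toSubmodule.subtype ∘ₗ Submodule.projection _ _ (D.isCompl_solv hΛ').symm

theorem abelComponent_add_nilComponent (hΛ' : Λ' ⊆ D.Λ) (X : D.solv hΛ') :
    D.abelComponent hΛ' X + D.nilComponent hΛ' X = X := by
  have := Submodule.projection_add_projection_eq_self (D.isCompl_solv hΛ') X
  exact congrArg Subtype.val this

theorem abelComponent_mem (hΛ' : Λ' ⊆ D.Λ) (X : D.solv hΛ') :
    D.abelComponent hΛ' X ∈ D.abelPart Λ' :=
  Submodule.projection_apply_mem (D.isCompl_solv hΛ') X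

theorem nilComponent_mem (hΛ' : Λ' ⊆ D.Λ) (X : D.solv hΛ') :
    D.nilComponent hΛ' X ∈ D.nilPart Λ' :=
  Submodule.projection_apply_mem (D.isCompl_solv hΛ').symm X

theorem components_eq (hΛ' : Λ' ⊆ D.Λ) {X : D.solv hΛ'} {A N : 𝔤} (hA : A ∈ D.𝔞)
    (hN : N ∈ D.nilPart ∅) (h : A + N = X) :
    D.abelComponent hΛ' X = A ∧ D.nilComponent hΛ' X = N := by
  have h1 := D.abelComponent_add_nilComponent hΛ' X
  have h2 : D.abelComponent hΛ' X - A = N - D.nilComponent hΛ' X := by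
    rw [sub_eq_sub_iff_add_eq_add, h1, ← h, add_comm]
  have h3 : D.abelComponent hΛ' X - A = 0 := by
    by_contra hne
    refine (D.Bσ.pos _ hne).ne' ?_
    nth_rewrite 2 [h2]
    exact D.Bσ_eq_zero_of_mem_nilPart (sub_mem (D.abelComponent_mem hΛ' X).1 hA)
      (sub_mem hN (D.nilPart_le_nilPart_empty Λ' (D.nilComponent_mem hΛ' X)))
  exact ⟨sub_eq_zero.1 h3, (sub_eq_zero.1 (h2 ▸ h3)).symm⟩

/-- The inner product `2 B_σ|_{𝔞_{Λ'} × 𝔞_{Λ'}} + B_σ|_{𝔫_{Λ'} × 𝔫_{Λ'}}` of the attached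
solvmanifold. -/
def metric (hΛ' : Λ' ⊆ D.Λ) : InnerProduct (D.solv hΛ') where
  form := (2 : ℝ) • D.Bσ.form.compl₁₂ (D.abelComponent hΛ') (D.abelComponent hΛ')
    + D.Bσ.form.compl₁₂ (D.nilComponent hΛ') (D.nilComponent hΛ')
  symm X Y := by
    simp only [LinearMap.add_apply, LinearMap.smul_apply, LinearMap.compl₁₂_apply]
    rw [D.Bσ.symm (D.abelComponent hΛ' X), D.Bσ.symm (D.nilComponent hΛ' X)]
  pos X hX := by
    simp only [LinearMap.add_apply, LinearMap.smul_apply, LinearMap.compl₁₂_apply, smul_eq_mul]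
    have h := D.abelComponent_add_nilComponent hΛ' X
    have h1 := D.Bσ.nonneg (D.abelComponent hΛ' X)
    have h2 := D.Bσ.nonneg (D.nilComponent hΛ' X)
    by_cases hA : D.abelComponent hΛ' X = 0
    · have hN : D.nilComponent hΛ' X ≠ 0 := by
        intro hN
        rw [hA, hN, add_zero] at h
        exact hX (Subtype.ext h.symm)
      have := D.Bσ.pos _ hN
      linarith
    · have := D.Bσ.pos _ hA
      linarith

/-- `⟨A + N, A' + N'⟩ = 2 B_σ(A,A') + B_σ(N,N')` for `A, A' ∈ 𝔞_{Λ'}` and `N, N' ∈ 𝔫_{Λ'}`. -/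
theorem metric_form_apply (hΛ' : Λ' ⊆ D.Λ) {X X' : D.solv hΛ'} {A N A' N' : 𝔤}
    (hA : A ∈ D.abelPart Λ') (hN : N ∈ D.nilPart Λ') (h : A + N = X)
    (hA' : A' ∈ D.abelPart Λ') (hN' : N' ∈ D.nilPart Λ') (h' : A' + N' = X') :
    (D.metric hΛ').form X X' = 2 * D.Bσ.form A A' + D.Bσ.form N N' := by
  have h1 := D.components_eq hΛ' hA.1 (D.nilPart_le_nilPart_empty Λ' hN) h
  have h2 := D.components_eq hΛ' hA'.1 (D.nilPart_le_nilPart_empty Λ' hN') h'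
  simp only [metric, LinearMap.add_apply, LinearMap.smul_apply, LinearMap.compl₁₂_apply,
    smul_eq_mul, h1.1, h1.2, h2.1, h2.2]

theorem solv_le_solv_empty (hΛ' : Λ' ⊆ D.Λ) : D.solv hΛ' ≤ D.solv (Set.empty_subset D.Λ) := by
  have h : D.abelPart Λ' ⊔ D.nilPart Λ' ≤ D.abelPart ∅ ⊔ D.nilPart ∅ := by
    refine sup_le_sup ?_ (D.nilPart_le_nilPart_empty Λ')
    rw [abelPart_empty]
    exact D.abelPart_le Λ'
  exact h

/-- The inclusion `𝔰_{Λ'} ⊆ 𝔰_∅`. -/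
def inclusion (hΛ' : Λ' ⊆ D.Λ) : D.solv hΛ' →ₗ⁅ℝ⁆ D.solv (Set.empty_subset D.Λ) :=
  LieSubalgebra.inclusion (D.solv_le_solv_empty hΛ')

end IwasawaData

end Solvmanifold

end

/-! Write H for the trace of the second fundamental form. The Koszul formula gives ⟨∇_X X, Z⟩ =
⟨[Z,X],X⟩, an expression that does not change when X, Z ∈ 𝔰_{Λ'} are viewed in 𝔰_∅; hence H has no
tangential part (`form_trace_inclusion`). For Z normal, ⟨H,Z⟩ = ∑⟨[Z,E_i],E_i⟩.

The normal space is spanned by the H_β with β ∈ ⟨Λ'⟩ and the 𝔤_β with β ∈ ⟨Λ'⟩ positive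
(`eq_zero_of_form_eq_zero`). Such a Z centralizes 𝔞_{Λ'} and normalizes 𝔫_{Λ'}, so ⟨H,Z⟩ is the
trace of ad Z on 𝔫_{Λ'} (`form_trace_of_trace_eq_zero`). That trace is zero because Z is a bracket
of two elements normalizing 𝔫_{Λ'}: H_β is a multiple of [X,σX] with X ∈ 𝔤_β, and Z ∈ 𝔤_β is a
multiple of [A,Z] for any A ∈ 𝔞 with β(A) ≠ 0 (`trace_adNil_lie`). -/

namespace Solvmanifold

/-- The trace of an endomorphism computed in an orthonormal basis. -/
theorem InnerProduct.IsOrthonormalBasis.sum_form_apply {V : Type*} [AddCommGroup V] [Module ℝ V]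
    {g : InnerProduct V} {n : ℕ} {e : Module.Basis (Fin n) ℝ V} (he : g.IsOrthonormalBasis e)
    (T : V →ₗ[ℝ] V) : ∑ i, g.form (T (e i)) (e i) = LinearMap.trace ℝ V T := by
  rw [LinearMap.trace_eq_matrix_trace ℝ e, Matrix.trace]
  refine Finset.sum_congr rfl fun i _ => ?_
  rw [Matrix.diag_apply, LinearMap.toMatrix_apply]
  conv_lhs => rw [← e.sum_repr (T (e i))]
  simp only [map_sum, map_smul, LinearMap.sum_apply, LinearMap.smul_apply, smul_eq_mul,
    he _ _, mul_ite, mul_one, mul_zero, Finset.sum_ite_eq', Finset.mem_univ, if_true]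

theorem InnerProduct.form_leviCivita_self {L : Type*} [LieRing L] [LieAlgebra ℝ L]
    [FiniteDimensional ℝ L] (g : InnerProduct L) (X Z : L) :
    g.form (g.leviCivita X X) Z = g.form ⁅Z, X⁆ X := by
  have h := g.two_mul_form_leviCivita X X Z
  rw [lie_self, map_zero, LinearMap.zero_apply, g.symm X ⁅Z, X⁆] at h
  linarith

/-! ### Restricted root spaces and the Cartan involution -/

namespace IwasawaData

variable {𝔤 : Type*} [LieRing 𝔤] [LieAlgebra ℝ 𝔤] (D : IwasawaData 𝔤)

/-- Since σA = -A, each ad A with A ∈ 𝔞 is self-adjoint for `Bσ`, and eigenvectors for distinct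
eigenvalues are orthogonal. -/
theorem Bσ_eq_zero_of_mem_rootSpace {α β : Module.Dual ℝ D.𝔞} (hne : α ≠ β) {X Y : 𝔤}
    (hX : X ∈ rootSpace D.𝔞 α) (hY : Y ∈ rootSpace D.𝔞 β) : D.Bσ.form X Y = 0 := by
  obtain ⟨A, hA⟩ : ∃ A, α A ≠ β A := by
    by_contra! h
    exact hne (LinearMap.ext h)
  have h := D.Bσ_lie X Y A
  rw [D.σ_apply_of_mem A.2, neg_lie, hX A, hY A] at h
  simp only [map_neg, neg_neg, map_smul, LinearMap.smul_apply, smul_eq_mul] at h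
  have h' : (α A - β A) * D.Bσ.form X Y = 0 := by linarith
  exact (mul_eq_zero.1 h').resolve_left (sub_ne_zero.2 hA)

theorem σ_mem_rootSpace {α : Module.Dual ℝ D.𝔞} {X : 𝔤} (hX : X ∈ rootSpace D.𝔞 α) :
    D.σ X ∈ rootSpace D.𝔞 (-α) := by
  intro A
  have h : ⁅(A : 𝔤), D.σ X⁆ = -D.σ ⁅(A : 𝔤), X⁆ := by
    rw [LieEquiv.map_lie, D.σ_apply_of_mem A.2, neg_lie, neg_neg]
  rw [h, hX A, map_smul, LinearMap.neg_apply, neg_smul]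

/-- Maximality of 𝔞: adjoining X to 𝔞 would again give an abelian subspace of 𝔭. -/
theorem mem_𝔞_of_lie_eq_zero {X : 𝔤} (hσ : D.σ X = -X) (hX : ∀ A ∈ D.𝔞, ⁅A, X⁆ = 0) :
    X ∈ D.𝔞 := by
  have hle : D.𝔞 ⊔ Submodule.span ℝ {X} ≤ D.𝔞 := by
    refine D.isMaximalAbelianSubspace.2 ⟨fun Y hY => ?_, fun Y hY Z hZ => ?_⟩ le_sup_left
    · obtain ⟨A, hA, T, hT, rfl⟩ := Submodule.mem_sup.1 hY
      obtain ⟨c, rfl⟩ := Submodule.mem_span_singleton.1 hT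
      rw [map_add, map_smul, hσ, D.σ_apply_of_mem hA, smul_neg, neg_add]
    · obtain ⟨A, hA, T, hT, rfl⟩ := Submodule.mem_sup.1 hY
      obtain ⟨c, rfl⟩ := Submodule.mem_span_singleton.1 hT
      obtain ⟨A', hA', T', hT', rfl⟩ := Submodule.mem_sup.1 hZ
      obtain ⟨c', rfl⟩ := Submodule.mem_span_singleton.1 hT'
      simp [D.lie_eq_zero hA hA', hX A hA, ← lie_skew X A', hX A' hA']
  exact hle (Submodule.mem_sup_right (Submodule.mem_span_singleton_self X))

/-- σ swaps the two factors, so the bracket lies in 𝔭; its weight α + (-α) = 0 makes it commute with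
𝔞. -/
theorem lie_σ_mem_𝔞 {α : Module.Dual ℝ D.𝔞} {X : 𝔤} (hX : X ∈ rootSpace D.𝔞 α) :
    ⁅X, D.σ X⁆ ∈ D.𝔞 := by
  refine D.mem_𝔞_of_lie_eq_zero ?_ fun A hA => ?_
  · rw [LieEquiv.map_lie, D.isCartanInvolution.involutive, lie_skew]
  · have h := D.lie_mem_rootSpace hX (D.σ_mem_rootSpace hX) ⟨A, hA⟩
    simpa using h

/-- The height of `exists_height` vanishes on the span of Λ' and is positive on the roots of 𝔫_{Λ'},
so adding γ keeps it positive. A root of positive height is a positive root outside ⟨Λ'⟩. The sign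
of γ plays no role, so negative root spaces of ⟨Λ'⟩ are covered too. -/
theorem lie_mem_nilPart_of_mem_span {Λ' : Set (Module.Dual ℝ D.𝔞)} (hΛ' : Λ' ⊆ D.Λ)
    {γ : Module.Dual ℝ D.𝔞} (hγ : γ ∈ Submodule.span ℝ Λ') {Z : 𝔤}
    (hZ : Z ∈ rootSpace D.𝔞 γ) : ∀ X ∈ D.nilPart Λ', ⁅Z, X⁆ ∈ D.nilPart Λ' := by
  obtain ⟨f, hf0, hf⟩ := D.exists_height hΛ'
  suffices h : D.nilPart Λ' ≤ (D.nilPart Λ').comap (LieAlgebra.ad ℝ 𝔤 Z : 𝔤 →ₗ[ℝ] 𝔤) from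
    fun X hX => h hX
  refine iSup₂_le fun β hβ X hX => ?_
  simp only [Submodule.mem_comap, LieAlgebra.ad_apply]
  by_cases h0 : ⁅Z, X⁆ = 0
  · rw [h0]
    exact zero_mem _
  have hmem := D.lie_mem_rootSpace hZ hX
  have hpos : 0 < f (γ + β) := by
    rw [map_add, hf0 γ hγ, zero_add]
    exact lt_of_le_of_ne (hf β hβ.1.2).1 fun h => hβ.2 ⟨hβ.1.1, (hf β hβ.1.2).2 h.symm⟩
  have hroot : γ + β ∈ roots D.𝔞 := by
    refine ⟨fun h => ?_, fun h => ?_⟩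
    · rw [h, map_zero] at hpos
      exact lt_irrefl _ hpos
    · rw [h] at hmem
      exact h0 (by simpa using hmem)
  refine D.rootSpace_le_nilPart ⟨⟨hroot, ?_⟩, fun h => hpos.ne' (hf0 _ h.2)⟩ hmem
  -- A negative root would have height at most 0.
  refine (D.isSimpleSystem.pos_or_neg _ hroot).resolve_right fun h => ?_
  have := (hf _ h).1
  rw [map_neg] at this
  linarith

variable [FiniteDimensional ℝ 𝔤]

/-- `[X, σX] = -B_σ(σX, σX) H_α` for `X ∈ 𝔤_α`. -/
theorem lie_σ_eq_smul_rootVector {α : Module.Dual ℝ D.𝔞} {X : 𝔤} (hX : X ∈ rootSpace D.𝔞 α) :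
    ⁅X, D.σ X⁆ = (-D.Bσ.form (D.σ X) (D.σ X)) • (D.rootVector α : 𝔤) := by
  have h : (⟨⁅X, D.σ X⁆, D.lie_σ_mem_𝔞 hX⟩ : D.𝔞)
      - (-D.Bσ.form (D.σ X) (D.σ X)) • D.rootVector α = 0 := by
    -- Both vectors lie in 𝔞, so it suffices to pair with A ∈ 𝔞; moving ad X across gives
    -- B_σ(σX,[A,σX]) = -α(A) B_σ(σX,σX).
    refine (D.Bσ.restrict D.𝔞).eq_zero_of_forall fun A => ?_
    change D.Bσ.form (⁅X, D.σ X⁆ - (-D.Bσ.form (D.σ X) (D.σ X)) • (D.rootVector α : 𝔤)) A = 0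
    have h1 := D.σ_mem_rootSpace hX A
    rw [map_sub, LinearMap.sub_apply, D.Bσ_lie, ← lie_skew, h1, map_smul, LinearMap.smul_apply,
      D.Bσ_rootVector]
    simp only [LinearMap.neg_apply, map_neg, map_smul, smul_eq_mul]
    ring
  exact congrArg Subtype.val (sub_eq_zero.1 h)

theorem exists_rootVector_eq_lie {α : Module.Dual ℝ D.𝔞} (hα : α ∈ roots D.𝔞) :
    ∃ X ∈ rootSpace D.𝔞 α, ∃ Y ∈ rootSpace D.𝔞 (-α), (D.rootVector α : 𝔤) = ⁅X, Y⁆ := by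
  obtain ⟨X, hX, hX0⟩ := Submodule.exists_mem_ne_zero_of_ne_bot hα.2
  have hσ : D.σ X ≠ 0 := fun h => hX0 (by
    rw [← D.isCartanInvolution.involutive X, h, map_zero])
  refine ⟨X, hX, (-D.Bσ.form (D.σ X) (D.σ X))⁻¹ • D.σ X,
    Submodule.smul_mem _ _ (D.σ_mem_rootSpace hX), ?_⟩
  rw [lie_smul, D.lie_σ_eq_smul_rootVector hX,
    inv_smul_smul₀ (neg_ne_zero.2 (D.Bσ.pos _ hσ).ne')]

/-! ### Traces of ad Z on 𝔫_{Λ'} -/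

variable {Λ' : Set (Module.Dual ℝ D.𝔞)} (hΛ' : Λ' ⊆ D.Λ)

/-- For `Z` normalizing `𝔫_{Λ'}`, the endomorphism of `𝔰_{Λ'}` which is `ad Z` on `𝔫_{Λ'}` and
zero on `𝔞_{Λ'}`. -/
noncomputable def adNil (Z : 𝔤) (hZ : ∀ X ∈ D.nilPart Λ', ⁅Z, X⁆ ∈ D.nilPart Λ') :
    D.solv hΛ' →ₗ[ℝ] D.solv hΛ' :=
  LinearMap.codRestrict (D.solv hΛ').toSubmodule
    ((LieAlgebra.ad ℝ 𝔤 Z : 𝔤 →ₗ[ℝ] 𝔤) ∘ₗ D.nilComponent hΛ')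
    fun X => Submodule.mem_sup_right (hZ _ (D.nilComponent_mem hΛ' X))

theorem coe_adNil (Z : 𝔤) (hZ : ∀ X ∈ D.nilPart Λ', ⁅Z, X⁆ ∈ D.nilPart Λ') (X : D.solv hΛ') :
    (D.adNil hΛ' Z hZ X : 𝔤) = ⁅Z, D.nilComponent hΛ' X⁆ := rfl

theorem nilComponent_adNil (Z : 𝔤) (hZ : ∀ X ∈ D.nilPart Λ', ⁅Z, X⁆ ∈ D.nilPart Λ')
    (X : D.solv hΛ') :
    D.nilComponent hΛ' (D.adNil hΛ' Z hZ X) = ⁅Z, D.nilComponent hΛ' X⁆ :=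
  (D.components_eq hΛ' (zero_mem _)
    (D.nilPart_le_nilPart_empty Λ' (hZ _ (D.nilComponent_mem hΛ' X)))
    (by rw [zero_add, coe_adNil])).2

/-- A commutator of endomorphisms has trace zero. X and Y range over 𝔤 and not just 𝔰_∅, because the
factor σX needed for H_β lies in a negative root space. -/
theorem trace_adNil_lie {Z X Y : 𝔤} (h : Z = ⁅X, Y⁆)
    (hX : ∀ N ∈ D.nilPart Λ', ⁅X, N⁆ ∈ D.nilPart Λ')
    (hY : ∀ N ∈ D.nilPart Λ', ⁅Y, N⁆ ∈ D.nilPart Λ')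
    (hZ : ∀ N ∈ D.nilPart Λ', ⁅Z, N⁆ ∈ D.nilPart Λ') :
    LinearMap.trace ℝ _ (D.adNil hΛ' Z hZ) = 0 := by
  have hcomm : D.adNil hΛ' Z hZ = D.adNil hΛ' X hX * D.adNil hΛ' Y hY
      - D.adNil hΛ' Y hY * D.adNil hΛ' X hX := by
    refine LinearMap.ext fun N => Subtype.ext ?_
    change _ = (D.adNil hΛ' X hX (D.adNil hΛ' Y hY N) : 𝔤)
      - (D.adNil hΛ' Y hY (D.adNil hΛ' X hX N) : 𝔤)
    rw [coe_adNil, coe_adNil, coe_adNil, nilComponent_adNil, nilComponent_adNil, h, lie_lie]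
  rw [hcomm, map_sub, LinearMap.trace_mul_comm, sub_self]

theorem apply_eq_zero_of_mem_abelPart {β : Module.Dual ℝ D.𝔞} (hβ : β ∈ D.spannedRoots Λ')
    {A : 𝔤} (hA : A ∈ D.abelPart Λ') : β ⟨A, hA.1⟩ = 0 := by
  rw [← D.Bσ_rootVector β ⟨A, hA.1⟩]
  exact hA.2 β hβ

/-! ### The isometric inclusion 𝔰_{Λ'} ⊆ 𝔰_∅ -/

theorem coe_inclusion (X : D.solv hΛ') : (D.inclusion hΛ' X : 𝔤) = X :=
  LieSubalgebra.coe_inclusion (D.solv_le_solv_empty hΛ') X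

theorem abelComponent_inclusion (X : D.solv hΛ') :
    D.abelComponent (Set.empty_subset D.Λ) (D.inclusion hΛ' X) = D.abelComponent hΛ' X :=
  (D.components_eq _ (D.abelComponent_mem hΛ' X).1
    (D.nilPart_le_nilPart_empty Λ' (D.nilComponent_mem hΛ' X))
    ((D.abelComponent_add_nilComponent hΛ' X).trans (D.coe_inclusion hΛ' X).symm)).1

theorem nilComponent_inclusion (X : D.solv hΛ') :
    D.nilComponent (Set.empty_subset D.Λ) (D.inclusion hΛ' X) = D.nilComponent hΛ' X :=
  (D.components_eq _ (D.abelComponent_mem hΛ' X).1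
    (D.nilPart_le_nilPart_empty Λ' (D.nilComponent_mem hΛ' X))
    ((D.abelComponent_add_nilComponent hΛ' X).trans (D.coe_inclusion hΛ' X).symm)).2

theorem metric_form (X Y : D.solv hΛ') : (D.metric hΛ').form X Y =
    2 * D.Bσ.form (D.abelComponent hΛ' X) (D.abelComponent hΛ' Y)
      + D.Bσ.form (D.nilComponent hΛ' X) (D.nilComponent hΛ' Y) := rfl

theorem metric_form_inclusion (X Y : D.solv hΛ') :
    (D.metric (Set.empty_subset D.Λ)).form (D.inclusion hΛ' X) (D.inclusion hΛ' Y)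
      = (D.metric hΛ').form X Y := by
  simp only [metric_form, abelComponent_inclusion, nilComponent_inclusion]

/-! ### The trace of the second fundamental form -/

/-- The trace of the second fundamental form is tangentially trivial. -/
theorem form_trace_inclusion {n : ℕ} (e : Fin n → D.solv hΛ') (Z : D.solv hΛ') :
    (D.metric (Set.empty_subset D.Λ)).form (∑ i, secondFundamentalForm (D.metric hΛ')
      (D.metric (Set.empty_subset D.Λ)) (D.inclusion hΛ') (e i) (e i)) (D.inclusion hΛ' Z) = 0 := by
  rw [map_sum, LinearMap.sum_apply]
  -- Each summand vanishes by itself, whether or not the family is orthonormal.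
  refine Finset.sum_eq_zero fun i _ => ?_
  rw [secondFundamentalForm, map_sub, LinearMap.sub_apply, InnerProduct.form_leviCivita_self,
    metric_form_inclusion, InnerProduct.form_leviCivita_self, ← LieHom.map_lie,
    metric_form_inclusion, sub_self]

/-- The trace of the second fundamental form is orthogonal to every normal vector `Z` centralizing
`𝔞_{Λ'}` and acting on `𝔫_{Λ'}` without trace. -/
theorem form_trace_of_trace_eq_zero {n : ℕ} {e : Module.Basis (Fin n) ℝ (D.solv hΛ')}
    (he : (D.metric hΛ').IsOrthonormalBasis e) (Z : D.solv (Set.empty_subset D.Λ))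
    (hA : ∀ A ∈ D.abelPart Λ', ⁅(Z : 𝔤), A⁆ = 0)
    (hN : ∀ X ∈ D.nilPart Λ', ⁅(Z : 𝔤), X⁆ ∈ D.nilPart Λ')
    (htr : LinearMap.trace ℝ _ (D.adNil hΛ' Z hN) = 0)
    (horth : ∀ X : D.solv hΛ',
      (D.metric (Set.empty_subset D.Λ)).form (D.inclusion hΛ' X) Z = 0) :
    (D.metric (Set.empty_subset D.Λ)).form (∑ i, secondFundamentalForm (D.metric hΛ')
      (D.metric (Set.empty_subset D.Λ)) (D.inclusion hΛ') (e i) (e i)) Z = 0 := by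
  rw [map_sum, LinearMap.sum_apply, ← htr, ← he.sum_form_apply]
  refine Finset.sum_congr rfl fun i _ => ?_
  -- Z kills the 𝔞_{Λ'}-component, so ad Z maps 𝔰_{Λ'} into itself and agrees there with `adNil`.
  have hlie : ⁅Z, D.inclusion hΛ' (e i)⁆ = D.inclusion hΛ' (D.adNil hΛ' Z hN (e i)) := by
    refine Subtype.ext ?_
    rw [LieSubalgebra.coe_bracket, coe_inclusion, coe_inclusion, coe_adNil]
    conv_lhs => rw [← D.abelComponent_add_nilComponent hΛ' (e i)]
    rw [lie_add, hA _ (D.abelComponent_mem hΛ' _), zero_add]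
  rw [secondFundamentalForm, map_sub, LinearMap.sub_apply, InnerProduct.form_leviCivita_self,
    horth, sub_zero, hlie, metric_form_inclusion]

theorem mem_solv_empty_of_mem_𝔞 {A : 𝔤} (hA : A ∈ D.𝔞) :
    A ∈ D.solv (Set.empty_subset D.Λ) :=
  Submodule.mem_sup_left (by rwa [abelPart_empty])

theorem mem_solv_empty_of_mem_nilPart {N : 𝔤} (hN : N ∈ D.nilPart ∅) :
    N ∈ D.solv (Set.empty_subset D.Λ) :=
  Submodule.mem_sup_right hN

theorem metric_form_of_mem_𝔞 (X : D.solv hΛ') {A : D.solv hΛ'} (hA : (A : 𝔤) ∈ D.𝔞) :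
    (D.metric hΛ').form X A = 2 * D.Bσ.form (D.abelComponent hΛ' X) A := by
  have h := D.components_eq hΛ' hA (zero_mem _) (add_zero (A : 𝔤))
  rw [metric_form, h.1, h.2, map_zero, add_zero]

theorem metric_form_of_mem_nilPart (X : D.solv hΛ') {N : D.solv hΛ'}
    (hN : (N : 𝔤) ∈ D.nilPart ∅) :
    (D.metric hΛ').form X N = D.Bσ.form (D.nilComponent hΛ' X) N := by
  have h := D.components_eq hΛ' (zero_mem _) hN (zero_add (N : 𝔤))
  rw [metric_form, h.1, h.2, map_zero, mul_zero, zero_add]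

theorem form_trace_rootVector {n : ℕ} {e : Module.Basis (Fin n) ℝ (D.solv hΛ')}
    (he : (D.metric hΛ').IsOrthonormalBasis e) {β : Module.Dual ℝ D.𝔞}
    (hβ : β ∈ D.spannedRoots Λ') :
    (D.metric (Set.empty_subset D.Λ)).form (∑ i, secondFundamentalForm (D.metric hΛ')
      (D.metric (Set.empty_subset D.Λ)) (D.inclusion hΛ') (e i) (e i))
      ⟨D.rootVector β, D.mem_solv_empty_of_mem_𝔞 (D.rootVector β).2⟩ = 0 := by
  refine D.form_trace_of_trace_eq_zero hΛ' he _
    (fun A hA => D.lie_eq_zero (D.rootVector β).2 hA.1)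
    (fun X hX => D.lie_mem_nilPart_of_mem (D.rootVector β).2 hX) ?_ fun X => ?_
  · obtain ⟨X, hX, Y, hY, h⟩ := D.exists_rootVector_eq_lie hβ.1
    exact D.trace_adNil_lie hΛ' h (D.lie_mem_nilPart_of_mem_span hΛ' hβ.2 hX)
      (D.lie_mem_nilPart_of_mem_span hΛ' (neg_mem hβ.2) hY) _
  · rw [metric_form_of_mem_𝔞 _ _ _ (D.rootVector β).2, abelComponent_inclusion, D.Bσ.symm,
      (D.abelComponent_mem hΛ' X).2 β hβ, mul_zero]

theorem form_trace_rootSpace {n : ℕ} {e : Module.Basis (Fin n) ℝ (D.solv hΛ')}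
    (he : (D.metric hΛ').IsOrthonormalBasis e) {β : Module.Dual ℝ D.𝔞}
    (hβ : β ∈ D.spannedRoots Λ') {Z : D.solv (Set.empty_subset D.Λ)}
    (hZ : (Z : 𝔤) ∈ rootSpace D.𝔞 β) (hZ' : (Z : 𝔤) ∈ D.nilPart ∅) :
    (D.metric (Set.empty_subset D.Λ)).form (∑ i, secondFundamentalForm (D.metric hΛ')
      (D.metric (Set.empty_subset D.Λ)) (D.inclusion hΛ') (e i) (e i)) Z = 0 := by
  refine D.form_trace_of_trace_eq_zero hΛ' he Z (fun A hA => ?_)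
    (D.lie_mem_nilPart_of_mem_span hΛ' hβ.2 hZ) ?_ fun X => ?_
  · have h : ⁅A, (Z : 𝔤)⁆ = β ⟨A, hA.1⟩ • (Z : 𝔤) := hZ ⟨A, hA.1⟩
    rw [← lie_skew, h, D.apply_eq_zero_of_mem_abelPart hβ hA, zero_smul, neg_zero]
  · obtain ⟨A, hA⟩ : ∃ A, β A ≠ 0 := by
      by_contra! h
      exact hβ.1.1 (LinearMap.ext h)
    have h : (Z : 𝔤) = ⁅(β A)⁻¹ • (A : 𝔤), (Z : 𝔤)⁆ := by
      rw [smul_lie, hZ A, inv_smul_smul₀ hA]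
    exact D.trace_adNil_lie hΛ' h
      (fun N hN => D.lie_mem_nilPart_of_mem (Submodule.smul_mem _ _ A.2) hN)
      (D.lie_mem_nilPart_of_mem_span hΛ' hβ.2 hZ) _
  · rw [metric_form_of_mem_nilPart _ _ _ hZ', nilComponent_inclusion, D.Bσ.symm]
    -- No root of 𝔫_{Λ'} equals β, as β lies in ⟨Λ'⟩; distinct root spaces are orthogonal.
    have hle : D.nilPart Λ' ≤ LinearMap.ker (D.Bσ.form (Z : 𝔤)) :=
      iSup₂_le fun γ hγ Y hY =>
        D.Bσ_eq_zero_of_mem_rootSpace (fun h : β = γ => hγ.2 (h ▸ hβ)) hZ hY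
    exact hle (D.nilComponent_mem hΛ' X)

/-- A vector of `𝔰_∅` orthogonal to `𝔰_{Λ'}`, to the root vectors of `⟨Λ'⟩` and to the positive
root spaces of `⟨Λ'⟩` vanishes. -/
theorem eq_zero_of_form_eq_zero {V : D.solv (Set.empty_subset D.Λ)}
    (h1 : ∀ X : D.solv hΛ', (D.metric (Set.empty_subset D.Λ)).form V (D.inclusion hΛ' X) = 0)
    (h2 : ∀ β ∈ D.spannedRoots Λ', (D.metric (Set.empty_subset D.Λ)).form V
      ⟨D.rootVector β, D.mem_solv_empty_of_mem_𝔞 (D.rootVector β).2⟩ = 0)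
    (h3 : ∀ β ∈ D.spannedRoots Λ', ∀ Z : D.solv (Set.empty_subset D.Λ),
      (Z : 𝔤) ∈ rootSpace D.𝔞 β → (Z : 𝔤) ∈ D.nilPart ∅ →
        (D.metric (Set.empty_subset D.Λ)).form V Z = 0) : V = 0 := by
  have hVA := (D.abelComponent_mem (Set.empty_subset D.Λ) V).1
  have hVN := D.nilComponent_mem (Set.empty_subset D.Λ) V
  have hA : D.abelComponent (Set.empty_subset D.Λ) V = 0 := by
    by_contra hne
    -- Orthogonality to every H_β puts the 𝔞-component of V in 𝔞_{Λ'}; it is then tangent, and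
    -- pairing it with V gives twice its square norm.
    have hmem : D.abelComponent (Set.empty_subset D.Λ) V ∈ D.abelPart Λ' := by
      refine ⟨hVA, fun β hβ => ?_⟩
      have h := h2 β hβ
      rw [metric_form_of_mem_𝔞 _ _ _ (D.rootVector β).2] at h
      rw [D.Bσ.symm]
      linarith
    have h := h1 ⟨_, Submodule.mem_sup_left hmem⟩
    rw [metric_form_of_mem_𝔞 _ _ _ (by rwa [coe_inclusion]), coe_inclusion] at h
    have hpos := D.Bσ.pos _ hne
    linarith
  have hN : D.nilComponent (Set.empty_subset D.Λ) V = 0 := by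
    by_contra hne
    refine (D.Bσ.pos _ hne).ne' ?_
    suffices hle : D.nilPart ∅ ≤
        LinearMap.ker (D.Bσ.form (D.nilComponent (Set.empty_subset D.Λ) V)) from hle hVN
    refine iSup₂_le fun β hβ Y hY => ?_
    have hY' : Y ∈ D.nilPart ∅ := D.rootSpace_le_nilPart hβ hY
    rw [LinearMap.mem_ker]
    -- A positive root space is either normal (β ∈ ⟨Λ'⟩) or contained in 𝔫_{Λ'}, hence tangent.
    by_cases hs : β ∈ D.spannedRoots Λ'
    · have h := h3 β hs ⟨Y, D.mem_solv_empty_of_mem_nilPart hY'⟩ hY hY'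
      rwa [metric_form_of_mem_nilPart _ _ _ hY'] at h
    · have h := h1 ⟨Y, Submodule.mem_sup_right (D.rootSpace_le_nilPart ⟨hβ.1, hs⟩ hY)⟩
      rwa [metric_form_of_mem_nilPart _ _ _ (by rwa [coe_inclusion]), coe_inclusion] at h
  have h := D.abelComponent_add_nilComponent (Set.empty_subset D.Λ) V
  rw [hA, hN, add_zero] at h
  exact Subtype.ext h.symm

end IwasawaData

end Solvmanifold

theorem theorem6p2 {𝔤 : Type*} [LieRing 𝔤] [LieAlgebra ℝ 𝔤] [FiniteDimensional ℝ 𝔤]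
    [LieAlgebra.IsSemisimple ℝ 𝔤] (D : Solvmanifold.IwasawaData 𝔤)
    (Λ' : Set (Module.Dual ℝ D.𝔞)) (hΛ' : Λ' ⊆ D.Λ) :
    Solvmanifold.IsMinimalSubmanifold (D.metric hΛ') (D.metric (Set.empty_subset D.Λ))
      (D.inclusion hΛ') where
  injective := LieSubalgebra.inclusion_injective (D.solv_le_solv_empty hΛ')
  isometric := D.metric_form_inclusion hΛ'
  trace_eq_zero e he := D.eq_zero_of_form_eq_zero hΛ' (D.form_trace_inclusion hΛ' e)
    (fun _ hβ => D.form_trace_rootVector hΛ' he hβ)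
    (fun _ hβ _ hZ hZ' => D.form_trace_rootSpace hΛ' he hβ hZ hZ')
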